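/- Let $k,n\in\mathbb N$ with $3\le k<n$, and let $K_n^{(k)}$ be the complete $k$-uniform hypergraph on $n$ vertices, whose edges are all $k$-element sets of vertices. A Berge cycle is an alternating sequence $v_1,e_1,v_2,e_2,\dots,v_m,e_m$ of distinct vertices $v_i$ and distinct edges $e_i$ such that each $e_i$ contains $v_i$ and $v_{i+1}$ (with $v_{m+1}:=v_1$). It is a Hamilton Berge cycle of a hypergraph $G$ if $\{v_1,\dots,v_m\}$ is the vertex set of $G$ and every $e_i$ is an edge of $G$. A decomposition of $G$ into Hamilton Berge cycles is a set of pairwise edge-disjoint Hamilton Berge cycles of $G$ that together contain all edges of $G$. For a set $M$ of edges of $G$, $G-M$ is obtained from $G$ by deleting the edges in $M$. A perfect matching of $G$ is a set of pairwise disjoint edges of $G$ covering all vertices. (i) Suppose that $k\ge 5$ and $n\ge 20$, or that $k=4$ and $n\ge 30$. Let $M$ be any set of fewer than $n$ edges of $K_n^{(k)}$ such that $n$ divides $|E(K_n^{(k)})\setminus M|$. Then $K_n^{(k)}-M$ has a decomposition into Hamilton Berge cycles. (ii) Suppose that $k=3$ and $n\ge 100$. If $n$ does not divide $\binom n3$,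 then $K_n^{(3)}$ has a perfect matching; let $M$ be any perfect matching of $K_n^{(3)}$ in this case, and let $M:=\emptyset$ otherwise. Then $K_n^{(3)}-M$ has a decomposition into Hamilton Berge cycles. -/

import Mathlib

namespace Hypergraph

/-- The complete `k`-uniform hypergraph `K_n^{(k)}`: its vertex set is `Fin n` and its edges are
all the `k`-element sets of vertices. -/
def completeUniform (n k : ℕ) : Hypergraph (Fin n) where
  vertexSet := Set.univ
  edgeSet := {e | e.ncard = k}
  subset_vertexSet_of_mem_edgeSet' := fun e _ => Set.subset_univ e

/-- `H.deleteEdges M` is the hypergraph `H - M`: same vertices, the edges in `M` are removed. -/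
def deleteEdges {α : Type*} (H : Hypergraph α) (M : Set (Set α)) : Hypergraph α where
  vertexSet := H.vertexSet
  edgeSet := H.edgeSet \ M
  subset_vertexSet_of_mem_edgeSet' := fun _ he => H.subset_vertexSet_of_mem_edgeSet' he.1

/-- A perfect matching of `H`: a set of pairwise disjoint edges of `H` covering all vertices. -/
structure IsPerfectMatching {α : Type*} (H : Hypergraph α) (M : Set (Set α)) : Prop where
  subset_edgeSet : M ⊆ H.edgeSet
  pairwiseDisjoint : M.PairwiseDisjoint id
  sUnion_eq : ⋃₀ M = H.vertexSet

end Hypergraph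

/-- A Berge cycle: an alternating sequence `v₁, e₁, v₂, …, vₘ, eₘ` of distinct vertices `vᵢ` and
distinct edges `eᵢ` such that each `eᵢ` contains `vᵢ` and `vᵢ₊₁`, indices being cyclic
(`finRotate m` maps `i` to `i + 1` modulo `m`). -/
structure BergeCycle (α : Type*) where
  length : ℕ
  vertex : Fin length → α
  edge : Fin length → Set α
  vertex_injective : Function.Injective vertex
  edge_injective : Function.Injective edge
  vertex_mem : ∀ i, vertex i ∈ edge i
  next_mem : ∀ i, vertex (finRotate length i) ∈ edge i

namespace BergeCycle

/-- The set of edges of a Berge cycle. -/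
def edgeSet {α : Type*} (C : BergeCycle α) : Set (Set α) := Set.range C.edge

/-- `C` is a Hamilton Berge cycle of `H`: its vertices are exactly the vertices of `H` and each of
its edges is an edge of `H`. -/
structure IsHamilton {α : Type*} (C : BergeCycle α) (H : Hypergraph α) : Prop where
  range_vertex : Set.range C.vertex = H.vertexSet
  edge_mem : ∀ i, C.edge i ∈ H.edgeSet

end BergeCycle

/-- `H` has a decomposition into Hamilton Berge cycles: there is a set of pairwise edge-disjoint
Hamilton Berge cycles of `H` containing all edges of `H`. -/
def Hypergraph.HasHamiltonBergeDecomposition {α : Type*} (H : Hypergraph α) : Prop :=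
  ∃ 𝒞 : Set (BergeCycle α),
    (∀ C ∈ 𝒞, C.IsHamilton H) ∧
    𝒞.PairwiseDisjoint BergeCycle.edgeSet ∧
    ∀ e ∈ H.edgeSet, ∃ C ∈ 𝒞, e ∈ C.edgeSet

/-!
Write `n = m + 1`. Fix a list of `t` Hamilton cycles of the complete *graph* on the `n` vertices,
where `t * n` is the number of hyperedges to be decomposed. The `t * n` steps of these cycles are
called slots, and each slot carries the pair of vertices that it joins (`slotPair`). A bijection
from the slots to the hyperedges that sends every slot to a hyperedge containing its pair turns
each cycle into a Hamilton Berge cycle, and together these form a decomposition. Such a bijection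
exists by Hall's theorem (`hasHamiltonBergeDecomposition_of_hall`) as soon as every set `S` of pairs
is met by at least as many hyperedges as there are slots with a pair in `S`; a hyperedge meets `S`
if it contains a member of `S`.

The cycles are the rotations of one zigzag cycle on `ZMod m` with a point at infinity. All `m`
rotations together cover every pair exactly twice (`exists_double_cover`). Used cyclically, they
give each pair `2 * q`, `2 * q + 1` or `2 * q + 2` slots, with `q = t / m`, which is the average up
to an error of `2`.

Hall's condition holds with room to spare because of an isoperimetric inequality: if `S` consists
of a proportion `x` of all pairs, then at most a proportion `(1 - x) * (1 - x / 2)` of the `k`-sets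
do not meet `S` (`card_independentSets_le`), while the average argument alone would only give
`1 - x`. For `k = 3` this bounds the number of triangles of a graph by means of the sum of the
squares of its degrees (`sum_mul_sum_le_of_complementary`); for larger `k` it follows by the local
LYM inequality. The gain `x * (1 - x) / 2` outweighs both the error in the number of slots and the
deleted hyperedges if the average number of slots per pair is large enough, which covers `k = 3`,
`k = 4`, and `5 ≤ k ≤ n - 5` (`hall_of_density`). For `n - 4 ≤ k < n` the average can be too small,
but then a `k`-set that does not meet `S` has a complement of at most four vertices that covers `S`;
hence few slots have their pair in `S`, whereas already the `k`-sets containing a single pair are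
more numerous (`hall_of_cover`).
-/

/-! ### Sets of vertices that contain no edge of a graph -/

/-- The vertex sets of size `k` that contain no member of `S`. -/
def independentSets {V : Type*} [Fintype V] [DecidableEq V] (S : Finset (Finset V)) (k : ℕ) :
    Finset (Finset V) :=
  {T ∈ Finset.univ.powersetCard k | ∀ e ∈ S, ¬ e ⊆ T}

section Independent

open Finset
open scoped FinsetFamily

variable {V : Type*} [Fintype V] [DecidableEq V]

theorem shadow_independentSets_subset (S : Finset (Finset V)) (k : ℕ) :
    ∂ (independentSets S (k + 1)) ⊆ independentSets S k := by
  intro T hT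
  obtain ⟨A, hA, a, ha, rfl⟩ := mem_shadow_iff.1 hT
  simp only [independentSets, mem_filter, mem_powersetCard_univ] at hA ⊢
  refine ⟨by rw [card_erase_of_mem ha, hA.1]; rfl, fun e he h => hA.2 e he (h.trans ?_)⟩
  exact erase_subset _ _

/-- The proportion of independent sets among all `k`-sets does not increase with `k`; this is the
local LYM inequality. -/
theorem card_independentSets_div_le (S : Finset (Finset V)) {j k : ℕ} (hjk : j ≤ k)
    (hk : k ≤ Fintype.card V) :
    (#(independentSets S k) : ℝ) / (Fintype.card V).choose k ≤
      (#(independentSets S j) : ℝ) / (Fintype.card V).choose j := by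
  induction k, hjk using Nat.le_induction with
  | base => exact le_rfl
  | succ k hjk ih =>
    refine le_trans ?_ (ih (by omega))
    have hs : (independentSets S (k + 1) : Set (Finset V)).Sized (k + 1) := by
      intro T hT
      simp only [independentSets, coe_filter, mem_powersetCard_univ, Set.mem_ofPred_eq] at hT
      exact hT.1
    refine (local_lubell_yamamoto_meshalkin_inequality_div (𝕜 := ℝ) (by omega) hs).trans ?_
    simp only [Nat.add_sub_cancel]
    gcongr
    exact shadow_independentSets_subset S k

/-- Summing over ordered pairs of vertices counts each member of a graph twice. -/
theorem sum_sum_pair_mem {S : Finset (Finset V)} (hS : ∀ e ∈ S, #e = 2) :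
    ∑ a, ∑ b, (if ({a, b} : Finset V) ∈ S then (1 : ℝ) else 0) = 2 * #S := by
  rw [← Fintype.sum_prod_type' (f := fun a b => if ({a, b} : Finset V) ∈ S then (1 : ℝ) else 0)]
  rw [Finset.sum_boole]
  have h := card_eq_sum_card_fiberwise (s := {p : V × V | ({p.1, p.2} : Finset V) ∈ S}) (t := S)
    (f := fun p => ({p.1, p.2} : Finset V)) (by intro p hp; simpa using hp)
  rw [h, Finset.sum_const_nat (m := 2)]
  · push_cast; ring
  · intro e he
    obtain ⟨x, y, hxy, rfl⟩ := card_eq_two.1 (hS e he)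
    have : ({p ∈ {p : V × V | ({p.1, p.2} : Finset V) ∈ S} | ({p.1, p.2} : Finset V) = {x, y}} :
        Finset (V × V)) = {(x, y), (y, x)} := by
      ext ⟨a, b⟩
      simp only [mem_filter, mem_univ, true_and, mem_insert, mem_singleton, Prod.mk.injEq]
      constructor
      · rintro ⟨-, h⟩
        have ha : a ∈ ({x, y} : Finset V) := h ▸ (by simp)
        have hb : b ∈ ({x, y} : Finset V) := h ▸ (by simp)
        have hx : x ∈ ({a, b} : Finset V) := h ▸ (by simp)
        have hy : y ∈ ({a, b} : Finset V) := h ▸ (by simp)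
        simp only [mem_insert, mem_singleton] at ha hb hx hy
        grind
      · rintro (⟨rfl, rfl⟩ | ⟨rfl, rfl⟩)
        · exact ⟨he, rfl⟩
        · exact ⟨by rwa [pair_comm], pair_comm _ _⟩
    rw [this, card_pair]
    simp [hxy]

/-- An isoperimetric inequality for complementary graphs `x` and `y`, given by their adjacency
matrices: the right-hand sum counts the pairs consisting of an edge of `x` and an edge of `y` that
share a vertex. To an edge `ab` of `x` and an edge `cd` of `y` the pair `ac` is interpolated: it
belongs to `x` or to `y`, and so one of `(ab, ac)` and `(ac, cd)` is counted on the right. -/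
theorem sum_mul_sum_le_of_complementary {x y : V → V → ℝ} (hx0 : ∀ a b, 0 ≤ x a b)
    (hy0 : ∀ a b, 0 ≤ y a b) (hx1 : ∀ a b, x a b ≤ 1) (hy1 : ∀ a b, y a b ≤ 1)
    (hxy : ∀ a b, a ≠ b → x a b + y a b = 1) (hxs : ∀ a b, x a b = x b a) :
    (∑ a, ∑ b, x a b) * (∑ a, ∑ b, y a b) ≤
      (2 * Fintype.card V + 1) * ∑ a, (∑ b, x a b) * (∑ b, y a b) := by
  have key : ∀ a b c d, x a b * y c d ≤
      (if a = c then x a b * y c d else 0) + (x a c * y c d + x a b * y a c) := by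
    intro a b c d
    by_cases h : a = c
    · rw [if_pos h]
      have := mul_nonneg (hx0 a c) (hy0 c d)
      have := mul_nonneg (hx0 a b) (hy0 a c)
      linarith
    · rw [if_neg h]
      have h1 := hxy a c h
      have h2 : x a b * (x a c * y c d) ≤ x a c * y c d :=
        mul_le_of_le_one_left (mul_nonneg (hx0 _ _) (hy0 _ _)) (hx1 _ _)
      have h3 : y c d * (x a b * y a c) ≤ x a b * y a c :=
        mul_le_of_le_one_left (mul_nonneg (hx0 _ _) (hy0 _ _)) (hy1 _ _)
      have h4 : x a b * y c d = x a b * (x a c * y c d) + y c d * (x a b * y a c) := by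
        calc x a b * y c d = x a b * y c d * (x a c + y a c) := by rw [h1, mul_one]
          _ = _ := by ring
      linarith
  have hsum : ∑ a, ∑ b, ∑ c, ∑ d, x a b * y c d ≤ ∑ a, ∑ b, ∑ c, ∑ d,
      ((if a = c then x a b * y c d else 0) + (x a c * y c d + x a b * y a c)) := by
    gcongr with a _ b _ c _ d _
    exact key a b c d
  have e0 : ∑ a, ∑ b, ∑ c, ∑ d, x a b * y c d = (∑ a, ∑ b, x a b) * (∑ a, ∑ b, y a b) := by
    simp_rw [sum_mul_sum]
    exact sum_congr rfl fun a _ => sum_comm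
  have e1 : ∑ a, ∑ b, ∑ c, ∑ d, (if a = c then x a b * y c d else 0) =
      ∑ a, (∑ b, x a b) * (∑ b, y a b) := by
    simp_rw [sum_mul_sum]
    refine sum_congr rfl fun a _ => sum_congr rfl fun b _ => ?_
    rw [sum_comm]
    simp
  have e2 : ∑ a, ∑ b : V, ∑ c, ∑ d, x a c * y c d =
      Fintype.card V * ∑ a, (∑ b, x a b) * (∑ b, y a b) := by
    simp only [sum_const, card_univ, nsmul_eq_mul, ← Finset.mul_sum]
    rw [sum_comm]
    simp only [Finset.sum_mul]
    congr 1
    exact sum_congr rfl fun c _ => sum_congr rfl fun a _ => by rw [hxs a c]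
  have e3 : ∑ a, ∑ b, ∑ c, ∑ _d : V, x a b * y a c =
      Fintype.card V * ∑ a, (∑ b, x a b) * (∑ b, y a b) := by
    simp only [sum_const, card_univ, nsmul_eq_mul, ← Finset.mul_sum, ← Finset.sum_mul]
  simp only [sum_add_distrib] at hsum
  rw [e0, e1, e2, e3] at hsum
  linarith

/-- A triangle of a graph with degrees `d a` is determined, at each of its three vertices `a`, by
a pair of neighbours of `a`. -/
theorem three_mul_card_independentSets_three_le (S : Finset (Finset V)) :
    3 * #(independentSets S 3) ≤
      ∑ a, (#{b | ({a, b} : Finset V) ∈ univ.powersetCard 2 \ S}).choose 2 := by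
  have h1 : 3 * #(independentSets S 3) = ∑ a, #{T ∈ independentSets S 3 | a ∈ T} := by
    have := sum_card_bipartiteAbove_eq_sum_card_bipartiteBelow (s := (univ : Finset V))
      (t := independentSets S 3) (fun a T => a ∈ T)
    unfold bipartiteAbove at this
    rw [this, Finset.sum_const_nat (m := 3), mul_comm]
    intro T hT
    simp only [independentSets, mem_filter, mem_powersetCard_univ] at hT
    simp [bipartiteBelow, hT.1]
  rw [h1]
  gcongr with a _
  rw [← card_powersetCard]
  apply card_le_card_of_injOn (fun T => T.erase a)
  · intro T hT
    simp only [independentSets, coe_filter, mem_filter, mem_powersetCard_univ,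
      Set.mem_ofPred_eq] at hT
    rw [mem_coe, mem_powersetCard]
    refine ⟨fun b hb => ?_, by rw [card_erase_of_mem hT.2, hT.1.1]⟩
    rw [mem_erase] at hb
    simp only [mem_filter, mem_univ, true_and, mem_sdiff, mem_powersetCard_univ]
    refine ⟨card_pair hb.1.symm, fun h => hT.1.2 _ h ?_⟩
    intro z hz
    simp only [mem_insert, mem_singleton] at hz
    rcases hz with rfl | rfl
    exacts [hT.2, hb.2]
  · intro T hT T' hT' h
    simp only [coe_filter, Set.mem_ofPred_eq] at hT hT'
    simp only at h
    rw [← insert_erase hT.2, ← insert_erase hT'.2, h]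

theorem card_independentSets_three_le {S : Finset (Finset V)} (hS : ∀ e ∈ S, #e = 2)
    (hV : 3 ≤ Fintype.card V) :
    (#(independentSets S 3) : ℝ) ≤ (Fintype.card V).choose 3 *
      ((1 - #S / (Fintype.card V).choose 2) * (1 - #S / (Fintype.card V).choose 2 / 2)) := by
  set n := Fintype.card V with hn
  set S' := (univ : Finset V).powersetCard 2 \ S with hS'
  have hS2 : ∀ e ∈ S', #e = 2 := fun e he => by
    rw [hS', mem_sdiff, mem_powersetCard_univ] at he
    exact he.1
  have hsub : S ⊆ (univ : Finset V).powersetCard 2 := fun e he => by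
    rw [mem_powersetCard_univ]; exact hS e he
  have hcard : (#S' : ℝ) = n.choose 2 - #S := by
    rw [hS', card_sdiff_of_subset hsub, Nat.cast_sub (card_le_card hsub), card_powersetCard,
      card_univ]
  have hx := sum_sum_pair_mem hS2
  have hy := sum_sum_pair_mem hS
  set x : V → V → ℝ := fun a b => if ({a, b} : Finset V) ∈ S' then 1 else 0 with hxdef
  set y : V → V → ℝ := fun a b => if ({a, b} : Finset V) ∈ S then 1 else 0 with hydef
  have hdeg : ∀ a, ∑ b, x a b = #{b | ({a, b} : Finset V) ∈ S'} := fun a => by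
    simp only [hxdef, sum_boole]
  have hone : ∀ a b, a ≠ b → x a b + y a b = 1 := by
    intro a b hab
    have : #({a, b} : Finset V) = 2 := card_pair hab
    by_cases h : ({a, b} : Finset V) ∈ S <;> simp [hxdef, hydef, hS', h, this]
  have hdeg' : ∀ a, ∑ b, y a b = n - 1 - ∑ b, x a b := by
    intro a
    have h0 : ∀ b, x a b + y a b = 1 - if a = b then 1 else 0 := by
      intro b
      split_ifs with h
      · subst h
        have h1 : ({a, a} : Finset V) ∉ S := fun h => by simpa using hS _ h
        have h2 : ({a, a} : Finset V) ∉ S' := fun h => by simpa using hS2 _ h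
        simp only [hxdef, hydef, if_neg h1, if_neg h2]
        norm_num
      · rw [hone a b h, sub_zero]
    have h1 : ∑ b, (x a b + y a b) = n - 1 := by
      simp_rw [h0]
      simp [hn]
    rw [sum_add_distrib] at h1
    linarith
  have hiso := sum_mul_sum_le_of_complementary (x := x) (y := y)
    (fun a b => by simp only [hxdef]; split_ifs <;> norm_num)
    (fun a b => by simp only [hydef]; split_ifs <;> norm_num)
    (fun a b => by simp only [hxdef]; split_ifs <;> norm_num)
    (fun a b => by simp only [hydef]; split_ifs <;> norm_num)
    hone (fun a b => by simp only [hxdef, pair_comm])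
  change ∑ a, ∑ b, x a b = _ at hx
  change ∑ a, ∑ b, y a b = _ at hy
  rw [hx, hy] at hiso
  have htri : 3 * (#(independentSets S 3) : ℝ) ≤ ∑ a, (∑ b, x a b) * (∑ b, x a b - 1) / 2 := by
    have h := three_mul_card_independentSets_three_le S
    have h' : ((3 * #(independentSets S 3) : ℕ) : ℝ) ≤
      ((∑ a, (#{b | ({a, b} : Finset V) ∈ S'}).choose 2 : ℕ) : ℝ) := by exact_mod_cast h
    push_cast [Nat.cast_choose_two] at h'
    simpa only [hdeg] using h'
  have hE : ∑ a, (∑ b, x a b) * (∑ b, y a b) =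
      2 * #S' * (n - 2) - 2 * ∑ a, (∑ b, x a b) * (∑ b, x a b - 1) / 2 := by
    rw [← hx, sum_mul, Finset.mul_sum, ← sum_sub_distrib]
    refine sum_congr rfl fun a _ => ?_
    rw [hdeg' a]
    ring
  rw [hE] at hiso
  have hn3 : (3 : ℝ) ≤ n := by exact_mod_cast hV
  have hN : (n.choose 2 : ℝ) = n * (n - 1) / 2 := Nat.cast_choose_two ℝ n
  have hP : (n.choose 3 : ℝ) = n.choose 2 * (n - 2) / 3 := by
    have := Nat.choose_succ_right_eq n 2
    have h' : ((n.choose 3 * 3 : ℕ) : ℝ) = ((n.choose 2 * (n - 2) : ℕ) : ℝ) := by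
      exact_mod_cast this
    rw [Nat.cast_mul, Nat.cast_mul, Nat.cast_sub (by omega)] at h'
    push_cast at h'
    linarith
  have hNpos : (0 : ℝ) < n.choose 2 := by rw [hN]; nlinarith
  have hrw : (n.choose 3 : ℝ) *
      ((1 - #S / (n.choose 2)) * (1 - #S / (n.choose 2) / 2)) =
      (n - 2) / 3 * (#S' - #S * #S' / n.choose 2 / 2) := by
    rw [hP, hcard]
    field_simp
  rw [hrw]
  have hss : (0 : ℝ) ≤ #S * #S' := by positivity
  -- `2 * n + 1` pairs with `n * (n - 1) / 2` because `(n - 2) * (2 * n + 1) ≤ 2 * n * (n - 1)`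
  have hfin : (n - 2) * ((#S : ℝ) * #S' / n.choose 2) ≤
      2 * #S' * (n - 2) - 6 * #(independentSets S 3) := by
    have h1 : (#S : ℝ) * #S' / n.choose 2 * ((n - 2) * (2 * n + 1)) ≤ 4 * (#S * #S') := by
      rw [div_mul_eq_mul_div, div_le_iff₀ hNpos, hN]
      nlinarith
    have h2 : 4 * ((#S : ℝ) * #S') ≤
        (2 * n + 1) * (2 * #S' * (n - 2) - 6 * #(independentSets S 3)) := by
      have h4 : (0 : ℝ) ≤ 2 * n + 1 := by positivity
      refine le_trans (le_of_eq (by ring)) (hiso.trans (mul_le_mul_of_nonneg_left ?_ h4))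
      linarith
    have h3 : (0 : ℝ) < 2 * n + 1 := by positivity
    refine le_of_mul_le_mul_left ?_ h3
    linarith
  linarith

/-- A graph with a proportion `x` of all pairs meets all but a proportion
`(1 - x) * (1 - x / 2)` of the `k`-sets. -/
theorem card_independentSets_le {S : Finset (Finset V)} (hS : ∀ e ∈ S, #e = 2) {k : ℕ}
    (hk : 3 ≤ k) (hkV : k ≤ Fintype.card V) :
    (#(independentSets S k) : ℝ) ≤ (Fintype.card V).choose k *
      ((1 - #S / (Fintype.card V).choose 2) * (1 - #S / (Fintype.card V).choose 2 / 2)) := by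
  have h1 := card_independentSets_div_le S hk hkV
  have h2 := card_independentSets_three_le hS (hk.trans hkV)
  have p1 : (0 : ℝ) < (Fintype.card V).choose k := by exact_mod_cast Nat.choose_pos hkV
  have p2 : (0 : ℝ) < (Fintype.card V).choose 3 := by
    exact_mod_cast Nat.choose_pos (hk.trans hkV)
  rw [← div_le_iff₀' p2] at h2
  rw [← div_le_iff₀' p1]
  exact h1.trans h2

end Independent

/-! ### Hamilton cycles covering all pairs equally often -/

section Cycles

open Finset

/-- The zigzag `0, -1, 1, -2, 2, …` through the integers. -/
def zigzag (j : ℕ) : ℤ :=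
  if j % 2 = 0 then j / 2 else -((j + 1) / 2)

theorem zigzag_injOn {m j j' : ℕ} (hj : j < m) (hj' : j' < m)
    (h : (zigzag j : ZMod m) = zigzag j') : j = j' := by
  rw [ZMod.intCast_eq_intCast_iff_dvd_sub] at h
  have h0 : zigzag j' - zigzag j = 0 := by
    refine Int.eq_zero_of_abs_lt_dvd h ?_
    rw [abs_lt]
    unfold zigzag
    split_ifs <;> omega
  unfold zigzag at h0
  split_ifs at h0 <;> omega

/-- The steps of the zigzag are `-1, 2, -3, …`. -/
theorem zigzag_succ_sub (j : ℕ) :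
    zigzag (j + 1) - zigzag j = if j % 2 = 0 then -((j : ℤ) + 1) else (j : ℤ) + 1 := by
  unfold zigzag
  split_ifs <;> push_cast <;> omega

/-- The vertex number `j` of the Hamilton cycle that visits the point `none` at infinity and then
follows the zigzag through `ZMod m`, rotated by `i`. -/
def rotatedZigzag (m : ℕ) (i : ZMod m) : ℕ → Option (ZMod m)
  | 0 => none
  | j + 1 => some (i + zigzag j)

theorem rotatedZigzag_injOn {m : ℕ} (i : ZMod m) {j j' : ℕ} (hj : j < m + 1) (hj' : j' < m + 1)
    (h : rotatedZigzag m i j = rotatedZigzag m i j') : j = j' := by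
  rcases j with _ | j <;> rcases j' with _ | j' <;> simp only [rotatedZigzag] at h
  · rfl
  · cases h
  · cases h
  · rw [zigzag_injOn (m := m) (by omega) (by omega) (add_left_cancel (Option.some.inj h))]

/-- The end of the step number `j`, where the last step returns to infinity. -/
def rotatedZigzagNext (m : ℕ) (i : ZMod m) (j : ℕ) : Option (ZMod m) :=
  rotatedZigzag m i (if j = m then 0 else j + 1)

/-- At most two of the steps of all rotated zigzags join given points `a` and `b`. If both are
finite, then up to sign `b - a` is the length `j` of the step, which leaves two choices for the
pair consisting of `j` and the sign; the pair determines the orientation of the step and hence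
the rotation. -/
theorem exists_injOn_bool {m : ℕ} (hm : 2 ≤ m) {a b : Option (ZMod m)} (hab : a ≠ b) :
    ∃ g : ZMod m × ℕ → Bool, ∀ p q : ZMod m × ℕ, p.2 < m + 1 → q.2 < m + 1 →
      (rotatedZigzag m p.1 p.2 = a ∧ rotatedZigzagNext m p.1 p.2 = b ∨
        rotatedZigzag m p.1 p.2 = b ∧ rotatedZigzagNext m p.1 p.2 = a) →
      (rotatedZigzag m q.1 q.2 = a ∧ rotatedZigzagNext m q.1 q.2 = b ∨
        rotatedZigzag m q.1 q.2 = b ∧ rotatedZigzagNext m q.1 q.2 = a) → g p = g q → p = q := by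
  -- the steps that meet infinity are the first and the last one
  have hinf : ∀ c : ZMod m, ∃ g : ZMod m × ℕ → Bool, ∀ p q : ZMod m × ℕ,
      p.2 < m + 1 → q.2 < m + 1 →
      (rotatedZigzag m p.1 p.2 = none ∧ rotatedZigzagNext m p.1 p.2 = some c ∨
        rotatedZigzag m p.1 p.2 = some c ∧ rotatedZigzagNext m p.1 p.2 = none) →
      (rotatedZigzag m q.1 q.2 = none ∧ rotatedZigzagNext m q.1 q.2 = some c ∨
        rotatedZigzag m q.1 q.2 = some c ∧ rotatedZigzagNext m q.1 q.2 = none) →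
      g p = g q → p = q := by
    intro c
    have key : ∀ (i : ZMod m) (j : ℕ),
        (rotatedZigzag m i j = none ∧ rotatedZigzagNext m i j = some c ∨
          rotatedZigzag m i j = some c ∧ rotatedZigzagNext m i j = none) →
        j = 0 ∧ i = c - zigzag 0 ∨ j = m ∧ i = c - zigzag (m - 1) := by
      rintro i (_ | j) (⟨h1, h2⟩ | ⟨h1, h2⟩)
      · left
        rw [rotatedZigzagNext, if_neg (by omega)] at h2
        refine ⟨rfl, ?_⟩
        rw [← Option.some.inj h2, add_sub_cancel_right]
      · cases h1
      · cases h1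
      · right
        unfold rotatedZigzagNext at h2
        split_ifs at h2 with hj
        · subst hj
          refine ⟨rfl, ?_⟩
          rw [← Option.some.inj h1, Nat.add_sub_cancel, add_sub_cancel_right]
        · cases h2
    refine ⟨fun p => decide (p.2 = 0), ?_⟩
    rintro ⟨i, j⟩ ⟨i', j'⟩ - - hp hq h
    rcases key i j hp with ⟨h1, h2⟩ | ⟨h1, h2⟩ <;> rcases key i' j' hq with ⟨h3, h4⟩ | ⟨h3, h4⟩
    · simp [h1, h2, h3, h4]
    · simp only [h1, h3, decide_true] at h
      simp at h
      omega
    · simp only [h1, h3, decide_true] at h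
      simp at h
      omega
    · simp [h1, h2, h3, h4]
  rcases a with _ | a <;> rcases b with _ | b
  · exact absurd rfl hab
  · exact hinf b
  · obtain ⟨g, hg⟩ := hinf a
    exact ⟨g, fun p q h1 h2 hp hq => hg p q h1 h2 (hp.symm.imp id id) (hq.symm.imp id id)⟩
  · have hne : a ≠ b := fun h => hab (by rw [h])
    -- an interior step `j + 1` goes from `i + zigzag j` to `i + zigzag (j + 1)`
    have key : ∀ (i : ZMod m) (j : ℕ) (c d : ZMod m), j < m + 1 →
        rotatedZigzag m i j = some c → rotatedZigzagNext m i j = some d →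
        ∃ l, j = l + 1 ∧ l + 1 < m ∧ i = c - zigzag l ∧
          d - c = if l % 2 = 0 then -((l + 1 : ℕ) : ZMod m) else ((l + 1 : ℕ) : ZMod m) := by
      rintro i (_ | l) c d hj h1 h2
      · cases h1
      · unfold rotatedZigzagNext at h2
        split_ifs at h2 with hl
        · cases h2
        · have e1 : i + zigzag l = c := Option.some.inj h1
          have e2 : i + zigzag (l + 1) = d := Option.some.inj h2
          refine ⟨l, rfl, by omega, by rw [← e1, add_sub_cancel_right], ?_⟩
          have := congrArg (Int.cast : ℤ → ZMod m) (zigzag_succ_sub l)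
          rw [← e1, ← e2, add_sub_add_left_eq_sub, ← Int.cast_sub, this]
          split_ifs <;> push_cast <;> rfl
    have cast_inj : ∀ l l' : ℕ, l + 1 < m → l' + 1 < m →
        ((l + 1 : ℕ) : ZMod m) = ((l' + 1 : ℕ) : ZMod m) → l = l' := by
      intro l l' h1 h2 h
      rw [ZMod.natCast_eq_natCast_iff', Nat.mod_eq_of_lt h1, Nat.mod_eq_of_lt h2] at h
      omega
    refine ⟨fun p => decide (rotatedZigzag m p.1 p.2 = some a) ^^ decide (p.2 % 2 = 0), ?_⟩
    rintro ⟨i, j⟩ ⟨i', j'⟩ hj hj' hp hq h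
    simp only at hj hj' hp hq h
    have hsome : (some b : Option (ZMod m)) ≠ some a := fun h => hne (Option.some.inj h).symm
    rcases hp with ⟨p1, p2⟩ | ⟨p1, p2⟩ <;> rcases hq with ⟨q1, q2⟩ | ⟨q1, q2⟩ <;>
      obtain ⟨l, rfl, hl, hi, hd⟩ := key i j _ _ hj p1 p2 <;>
      obtain ⟨l', rfl, hl', hi', hd'⟩ := key i' j' _ _ hj' q1 q2 <;>
      rw [p1, q1] at h
    · have hpar : l % 2 = l' % 2 := by
        by_cases e1 : (l + 1) % 2 = 0 <;> by_cases e2 : (l' + 1) % 2 = 0 <;>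
          simp [e1, e2] at h <;> omega
      rw [hpar] at hd
      have : l = l' := by
        apply cast_inj l l' hl hl'
        rw [hd] at hd'
        split_ifs at hd'
        · exact neg_injective hd'
        · exact hd'
      subst this
      rw [hi, hi']
    · have hpar : l % 2 ≠ l' % 2 := by
        by_cases e1 : (l + 1) % 2 = 0 <;> by_cases e2 : (l' + 1) % 2 = 0 <;>
          simp [e1, e2, hsome] at h <;> omega
      have : l = l' := by
        apply cast_inj l l' hl hl'
        rw [← neg_sub, hd] at hd'
        split_ifs at hd'
        · omega
        · rwa [neg_neg] at hd'
        · exact neg_injective hd'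
        · omega
      omega
    · have hpar : l % 2 ≠ l' % 2 := by
        by_cases e1 : (l + 1) % 2 = 0 <;> by_cases e2 : (l' + 1) % 2 = 0 <;>
          simp [e1, e2, hsome] at h <;> omega
      have : l = l' := by
        apply cast_inj l l' hl hl'
        rw [← neg_sub, hd] at hd'
        split_ifs at hd'
        · omega
        · rwa [neg_neg] at hd'
        · exact neg_injective hd'
        · omega
      omega
    · have hpar : l % 2 = l' % 2 := by
        by_cases e1 : (l + 1) % 2 = 0 <;> by_cases e2 : (l' + 1) % 2 = 0 <;>
          simp [e1, e2, hsome] at h <;> omega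
      rw [hpar] at hd
      have : l = l' := by
        apply cast_inj l l' hl hl'
        rw [hd] at hd'
        split_ifs at hd'
        · exact neg_injective hd'
        · exact hd'
      subst this
      rw [hi, hi']

/-- The pair of consecutive vertices number `p.2` and `p.2 + 1` of the cycle `σ p.1`. -/
def slotPair {ι : Type*} {m : ℕ} (σ : ι → Fin (m + 1) → Fin (m + 1)) (p : ι × Fin (m + 1)) :
    Finset (Fin (m + 1)) :=
  {σ p.1 p.2, σ p.1 (p.2 + 1)}

theorem card_slotPair {ι : Type*} {m : ℕ} (hm : 1 ≤ m) {σ : ι → Fin (m + 1) → Fin (m + 1)}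
    (hσ : ∀ i, Function.Injective (σ i)) (p : ι × Fin (m + 1)) : #(slotPair σ p) = 2 := by
  apply card_pair
  intro h
  have := hσ _ h
  have h1 : (1 : Fin (m + 1)) = 0 := by simpa using this
  have := congrArg Fin.val h1
  rw [Fin.val_one', Fin.val_zero, Nat.mod_eq_of_lt (by omega)] at this
  omega

/-- There are `m` Hamilton cycles of the complete graph on `m + 1` vertices that together cover
every edge exactly twice. It suffices that no edge is covered more often, as the total number of
steps is twice the number of edges. -/
theorem exists_double_cover {m : ℕ} (hm : 2 ≤ m) :
    ∃ σ : Fin m → Fin (m + 1) → Fin (m + 1), (∀ i, Function.Injective (σ i)) ∧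
      ∀ e : Finset (Fin (m + 1)), #e = 2 → #{p | slotPair σ p = e} = 2 := by
  have : NeZero m := ⟨by omega⟩
  have hcard : Fintype.card (Option (ZMod m)) = Fintype.card (Fin (m + 1)) := by
    rw [Fintype.card_option, ZMod.card, Fintype.card_fin]
  let E := Fintype.equivOfCardEq hcard
  have hcard' : Fintype.card (Fin m) = Fintype.card (ZMod m) := by
    rw [ZMod.card, Fintype.card_fin]
  let F := Fintype.equivOfCardEq hcard'
  let σ : Fin m → Fin (m + 1) → Fin (m + 1) := fun i j => E (rotatedZigzag m (F i) j)
  have hσ : ∀ i, Function.Injective (σ i) := fun i j j' h =>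
    Fin.ext (rotatedZigzag_injOn (F i) j.2 j'.2 (E.injective h))
  have hnext : ∀ i j, σ i (j + 1) = E (rotatedZigzagNext m (F i) j) := by
    intro i j
    simp only [σ, rotatedZigzagNext]
    congr 2
    split_ifs with h
    · have : j = Fin.last m := Fin.ext h
      rw [this, Fin.last_add_one, Fin.val_zero]
    · exact Fin.val_add_one_of_lt (by rw [Fin.lt_def, Fin.val_last]; omega)
  have hle : ∀ e ∈ (univ : Finset (Fin (m + 1))).powersetCard 2,
      #{p | slotPair σ p = e} ≤ 2 := by
    intro e he
    rw [mem_powersetCard_univ] at he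
    obtain ⟨u, v, huv, rfl⟩ := card_eq_two.1 he
    obtain ⟨g, hg⟩ := exists_injOn_bool hm (a := E.symm u) (b := E.symm v)
      (fun h => huv (E.symm.injective h))
    have hend : ∀ p : Fin m × Fin (m + 1), slotPair σ p = {u, v} →
        rotatedZigzag m (F p.1) p.2 = E.symm u ∧ rotatedZigzagNext m (F p.1) p.2 = E.symm v ∨
        rotatedZigzag m (F p.1) p.2 = E.symm v ∧ rotatedZigzagNext m (F p.1) p.2 = E.symm u := by
      intro p hp
      have hp' := congrArg (fun s : Finset _ => (s : Set (Fin (m + 1)))) hp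
      simp only [slotPair, coe_pair, Set.pair_eq_pair_iff, hnext] at hp'
      simpa only [Equiv.eq_symm_apply] using hp'
    calc #{p | slotPair σ p = {u, v}} ≤ #(univ : Finset Bool) := by
          refine card_le_card_of_injOn (fun p => g (F p.1, p.2)) (fun _ _ => mem_univ _) ?_
          rintro ⟨i, j⟩ hp ⟨i', j'⟩ hq h
          rw [mem_coe, mem_filter] at hp hq
          have := hg (F i, j) (F i', j') j.2 j'.2 (hend _ hp.2) (hend _ hq.2) h
          rw [Prod.mk.injEq] at this ⊢
          exact ⟨F.injective this.1, Fin.ext this.2⟩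
      _ = 2 := rfl
  have htot : ∑ e ∈ (univ : Finset (Fin (m + 1))).powersetCard 2, #{p | slotPair σ p = e} =
      ∑ e ∈ (univ : Finset (Fin (m + 1))).powersetCard 2, 2 := by
    rw [← card_eq_sum_card_fiberwise
      (fun p _ => mem_coe.2 (mem_powersetCard_univ.2 (card_slotPair (by omega) hσ p))), card_univ,
      Fintype.card_prod, Fintype.card_fin, Fintype.card_fin, sum_const, card_powersetCard,
      card_univ, Fintype.card_fin, smul_eq_mul, Nat.choose_two_right, Nat.add_sub_cancel,
      Nat.div_mul_cancel (by rw [mul_comm]; exact (Nat.even_mul_succ_self m).two_dvd), mul_comm]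
  refine ⟨σ, hσ, fun e he => ?_⟩
  exact (sum_eq_sum_iff_of_le hle).1 htot e (mem_powersetCard_univ.2 he)

/-- Repeating a double cover cyclically gives any number `t` of Hamilton cycles that cover all
edges about equally often. -/
theorem exists_balanced_cycles {m : ℕ} (hm : 2 ≤ m) (t : ℕ) :
    ∃ τ : Fin t → Fin (m + 1) → Fin (m + 1), (∀ c, Function.Injective (τ c)) ∧
      ∀ e : Finset (Fin (m + 1)), #e = 2 →
        2 * (t / m) ≤ #{p | slotPair τ p = e} ∧ #{p | slotPair τ p = e} ≤ 2 * (t / m) + 2 := by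
  obtain ⟨σ, hσ, h2⟩ := exists_double_cover hm
  have hm0 : 0 < m := by omega
  let r : Fin t → Fin m := fun c => ⟨c % m, Nat.mod_lt _ hm0⟩
  have hr : ∀ i : Fin m, t / m ≤ #{c | r c = i} ∧ #{c | r c = i} ≤ t / m + 1 := by
    intro i
    have h := Nat.count_modEq_card t hm0 i
    have h' : #{c | r c = i} = Nat.count (· ≡ i [MOD m]) t := by
      rw [Nat.count_eq_card_filter_range, ← card_map Fin.valEmbedding]
      congr 1
      ext x
      simp only [mem_map, mem_filter, mem_univ, true_and, Fin.valEmbedding_apply, mem_range, r,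
        Fin.ext_iff, Nat.ModEq, Nat.mod_eq_of_lt i.2]
      constructor
      · rintro ⟨c, hc, rfl⟩
        exact ⟨c.2, hc⟩
      · rintro ⟨hx, hc⟩
        exact ⟨⟨x, hx⟩, hc, rfl⟩
    rw [h', h]
    split_ifs <;> omega
  refine ⟨fun c => σ (r c), fun c => hσ _, fun e he => ?_⟩
  have hsum : #{p | slotPair (fun c => σ (r c)) p = e} =
      ∑ p ∈ {p | slotPair σ p = e}, #{c | r c = p.1} := by
    rw [card_eq_sum_card_fiberwise (f := fun p : Fin t × Fin (m + 1) => (r p.1, p.2))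
      (t := {p | slotPair σ p = e})]
    · refine sum_congr rfl fun p hp => ?_
      refine card_bij' (fun q _ => q.1) (fun c _ => (c, p.2)) ?_ ?_ ?_ ?_
      · rintro q hq
        simp only [mem_filter, mem_univ, true_and] at hq ⊢
        rw [← hq.2]
      · rintro c hc
        simp only [mem_filter, mem_univ, true_and] at hc hp ⊢
        rw [hc]
        refine ⟨?_, rfl⟩
        rw [← hp, slotPair, slotPair, hc]
      · rintro q hq
        simp only [mem_filter, mem_univ, true_and] at hq
        rw [← hq.2]
      · intro c _
        rfl
    · intro p hp
      rw [mem_coe, mem_filter] at hp ⊢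
      exact ⟨mem_univ _, hp.2⟩
  rw [hsum]
  constructor
  · calc 2 * (t / m) = ∑ p ∈ {p | slotPair σ p = e}, t / m := by
          rw [sum_const, h2 e he, smul_eq_mul]
      _ ≤ _ := sum_le_sum fun p _ => (hr p.1).1
  · calc _ ≤ ∑ p ∈ {p | slotPair σ p = e}, (t / m + 1) := sum_le_sum fun p _ => (hr p.1).2
      _ = 2 * (t / m) + 2 := by rw [sum_const, h2 e he, smul_eq_mul]; ring

/-- Each Hamilton cycle has two steps at every vertex. -/
theorem card_slotPair_mem_le {m t : ℕ} {τ : Fin t → Fin (m + 1) → Fin (m + 1)}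
    (hτ : ∀ c, Function.Injective (τ c)) (v : Fin (m + 1)) :
    #{p | v ∈ slotPair τ p} ≤ 2 * t := by
  calc #{p | v ∈ slotPair τ p} ≤ #(univ : Finset (Fin t × Bool)) := by
        refine card_le_card_of_injOn (fun p => (p.1, decide (τ p.1 p.2 = v)))
          (fun _ _ => mem_univ _) ?_
        rintro ⟨c, j⟩ hp ⟨c', j'⟩ hq h
        simp only [Prod.mk.injEq] at h
        obtain ⟨rfl, h⟩ := h
        simp only [slotPair, mem_coe, mem_filter, mem_univ, true_and, mem_insert,
          mem_singleton] at hp hq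
        rw [Prod.mk.injEq]
        refine ⟨rfl, ?_⟩
        by_cases h1 : τ c j = v
        · simp only [h1, decide_true] at h
          exact hτ c (h1.trans (of_decide_eq_true h.symm).symm)
        · simp only [h1, decide_false] at h
          have h2 : τ c j' ≠ v := of_decide_eq_false h.symm
          have e1 : v = τ c (j + 1) := hp.resolve_left fun h => h1 h.symm
          have e2 : v = τ c (j' + 1) := hq.resolve_left fun h => h2 h.symm
          exact add_right_cancel (hτ c (e1.symm.trans e2))
    _ = 2 * t := by simp [mul_comm]

end Cycles

/-! ### Hall's condition -/

section Hall

open Finset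

theorem hasHamiltonBergeDecomposition_of_hall {m t : ℕ} {G : Finset (Finset (Fin (m + 1)))}
    {τ : Fin t → Fin (m + 1) → Fin (m + 1)} (hm : 1 ≤ m) (hτ : ∀ c, Function.Injective (τ c))
    (hG : #G = t * (m + 1))
    (hall : ∀ S : Finset (Finset (Fin (m + 1))), (∀ e ∈ S, #e = 2) → S.Nonempty →
      #{p | slotPair τ p ∈ S} ≤ #{T ∈ G | ∃ e ∈ S, e ⊆ T})
    {H : Hypergraph (Fin (m + 1))} (hV : H.vertexSet = Set.univ)
    (hE : ∀ e, e ∈ H.edgeSet ↔ ∃ T ∈ G, (T : Set (Fin (m + 1))) = e) :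
    H.HasHamiltonBergeDecomposition := by
  obtain ⟨f, hf, hmem⟩ := (Finset.all_card_le_biUnion_card_iff_exists_injective
    (fun p : Fin t × Fin (m + 1) => {T ∈ G | slotPair τ p ⊆ T})).1 (by
      intro A
      rcases A.eq_empty_or_nonempty with rfl | hA
      · simp
      calc #A ≤ #{p | slotPair τ p ∈ A.image (slotPair τ)} :=
            card_le_card fun p hp => by
              rw [mem_filter]
              exact ⟨mem_univ _, mem_image_of_mem _ hp⟩
        _ ≤ #{T ∈ G | ∃ e ∈ A.image (slotPair τ), e ⊆ T} := by
            refine hall _ (fun e he => ?_) (hA.image _)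
            obtain ⟨p, -, rfl⟩ := mem_image.1 he
            exact card_slotPair hm hτ p
        _ ≤ _ := card_le_card fun T hT => by
            rw [mem_filter] at hT
            obtain ⟨hTG, e, he, heT⟩ := hT
            obtain ⟨p, hp, rfl⟩ := mem_image.1 he
            exact mem_biUnion.2 ⟨p, hp, mem_filter.2 ⟨hTG, heT⟩⟩)
  have hfG : ∀ p, f p ∈ G := fun p => (mem_filter.1 (hmem p)).1
  have hfsub : ∀ p, slotPair τ p ⊆ f p := fun p => (mem_filter.1 (hmem p)).2
  have himg : univ.image f = G := by
    refine eq_of_subset_of_card_le (fun T hT => ?_) ?_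
    · obtain ⟨p, -, rfl⟩ := mem_image.1 hT
      exact hfG p
    · rw [card_image_of_injective _ hf, card_univ, hG]
      simp
  let C : Fin t → BergeCycle (Fin (m + 1)) := fun c =>
    { length := m + 1
      vertex := τ c
      edge := fun j => f (c, j)
      vertex_injective := hτ c
      edge_injective := fun j j' h => (Prod.mk.inj (hf (Finset.coe_injective h))).2
      vertex_mem := fun j => hfsub (c, j) (mem_insert_self _ _)
      next_mem := fun j => by
        rw [finRotate_apply]
        exact hfsub (c, j) (mem_insert_of_mem (mem_singleton_self _)) }
  refine ⟨Set.range C, ?_, ?_, ?_⟩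
  · rintro _ ⟨c, rfl⟩
    refine ⟨?_, fun j => (hE _).2 ⟨f (c, j), hfG _, rfl⟩⟩
    rw [hV]
    exact (Finite.injective_iff_surjective.1 (hτ c)).range_eq
  · rintro _ ⟨c, rfl⟩ _ ⟨c', rfl⟩ hne
    rw [Function.onFun, Set.disjoint_left]
    rintro _ ⟨j, rfl⟩ ⟨j', h⟩
    have := (Prod.mk.inj (hf (Finset.coe_injective h))).1
    exact hne (by rw [this])
  · intro e he
    obtain ⟨T, hT, rfl⟩ := (hE e).1 he
    rw [← himg] at hT
    obtain ⟨⟨c, j⟩, -, rfl⟩ := mem_image.1 hT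
    exact ⟨C c, ⟨c, rfl⟩, j, rfl⟩

variable {m t k : ℕ} {τ : Fin t → Fin (m + 1) → Fin (m + 1)}
  {M S : Finset (Finset (Fin (m + 1)))}

/-- The `k`-sets are those outside `M` that meet `S`, those in `M` that meet `S`, and the
independent ones. -/
theorem card_touching_add (hM : M ⊆ powersetCard k univ) :
    #{T ∈ powersetCard k univ \ M | ∃ e ∈ S, e ⊆ T} + #{T ∈ M | ∃ e ∈ S, e ⊆ T} +
      #(independentSets S k) = (m + 1).choose k := by
  rw [← card_union_of_disjoint (disjoint_filter_filter sdiff_disjoint), ← filter_union,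
    sdiff_union_of_subset hM]
  have h : independentSets S k =
      {T ∈ powersetCard k (univ : Finset (Fin (m + 1))) | ¬ ∃ e ∈ S, e ⊆ T} := by
    unfold independentSets
    congr 1
    ext T
    push Not
    rfl
  rw [h, card_filter_add_card_filter_not, card_powersetCard, card_univ, Fintype.card_fin]

theorem card_slots_eq_sum (S : Finset (Finset (Fin (m + 1)))) :
    #{p | slotPair τ p ∈ S} = ∑ e ∈ S, #{p | slotPair τ p = e} := by
  rw [card_eq_sum_card_fiberwise (f := slotPair τ) (t := S) (by
    intro p hp
    simpa using hp)]
  refine sum_congr rfl fun e he => ?_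
  congr 1
  ext p
  simp only [mem_filter, mem_univ, true_and]
  exact ⟨fun h => h.2, fun h => ⟨h ▸ he, h⟩⟩

theorem card_slots_add_card_slots_compl (hm : 1 ≤ m) (hτ : ∀ c, Function.Injective (τ c)) :
    #{p | slotPair τ p ∈ S} + #{p | slotPair τ p ∈ powersetCard 2 univ \ S} = t * (m + 1) := by
  have h : (univ.filter fun p => slotPair τ p ∈ powersetCard 2 univ \ S) =
      univ.filter fun p => ¬ slotPair τ p ∈ S := by
    ext p
    simp [card_slotPair hm hτ p]
  rw [h, card_filter_add_card_filter_not, card_univ, Fintype.card_prod, Fintype.card_fin,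
    Fintype.card_fin]

/-- Hall's condition for a set `S` of pairs. The first alternative is used when `S` contains at
most half of all pairs: then the `k`-sets that meet `S` are compared with an upper bound for the
number of slots. Otherwise the number of independent `k`-sets is compared with a lower bound for
the number of slots outside `S`. -/
theorem hall_of_density (hm : 2 ≤ m) (hτ : ∀ c, Function.Injective (τ c))
    (hbal : ∀ e : Finset (Fin (m + 1)), #e = 2 →
      2 * (t / m) ≤ #{p | slotPair τ p = e} ∧ #{p | slotPair τ p = e} ≤ 2 * (t / m) + 2)
    (hM : M ⊆ powersetCard k univ) (hMm : #M ≤ m) (ht : t * (m + 1) + #M = (m + 1).choose k)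
    (hk : 3 ≤ k) (hkm : k ≤ m + 1)
    (hρ : (8 : ℝ) ≤ (m + 1).choose k / (m + 1).choose 2)
    (hS : ∀ e ∈ S, #e = 2)
    (hsmall : 2 * #S ≤ (m + 1).choose 2 → (2 * #S + #{T ∈ M | ∃ e ∈ S, e ⊆ T} : ℝ) ≤
      (m + 1).choose k / (m + 1).choose 2 * #S * (1 - #S / (m + 1).choose 2) / 2) :
    #{p | slotPair τ p ∈ S} ≤ #{T ∈ powersetCard k univ \ M | ∃ e ∈ S, e ⊆ T} := by
  have hi := card_independentSets_le hS hk (by simpa using hkm)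
  rw [Fintype.card_fin] at hi
  have htouch := card_touching_add (S := S) hM
  have hsub : S ⊆ powersetCard 2 univ := fun e he => mem_powersetCard_univ.2 (hS e he)
  have hScard : #S ≤ (m + 1).choose 2 := by
    simpa using card_le_card hsub
  have hcompl : #(powersetCard 2 univ \ S) = (m + 1).choose 2 - #S := by
    rw [card_sdiff_of_subset hsub, card_powersetCard, card_univ, Fintype.card_fin]
  have hMS : #{T ∈ M | ∃ e ∈ S, e ⊆ T} ≤ #M := card_filter_le _ _
  set q := t / m with hq
  set N := (m + 1).choose 2 with hN
  set P := (m + 1).choose k with hP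
  have hNpos : 0 < N := Nat.choose_pos (by omega)
  have hN2 : 2 * N = (m + 1) * m := by
    rw [hN, Nat.choose_two_right, Nat.add_sub_cancel, Nat.mul_div_cancel']
    rw [mul_comm]
    exact (Nat.even_mul_succ_self m).two_dvd
  have hqt : q * m ≤ t := Nat.div_mul_le_self t m
  have htq : t + 1 ≤ (q + 1) * m := by
    have := Nat.lt_mul_div_succ t (show 0 < m by omega)
    rw [← hq] at this
    linarith
  -- the average multiplicity of a pair lies between `2 * q` and `2 * q + 2`
  have hlow : 2 * q * N ≤ P := by
    calc 2 * q * N = q * m * (m + 1) := by linear_combination q * hN2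
      _ ≤ t * (m + 1) := Nat.mul_le_mul_right _ hqt
      _ ≤ P := by omega
  have hupp : P ≤ (2 * q + 2) * N := by
    calc P ≤ (t + 1) * (m + 1) := by rw [add_mul]; omega
      _ ≤ (q + 1) * m * (m + 1) := Nat.mul_le_mul_right _ htq
      _ = (2 * q + 2) * N := by
          rw [show (2 * q + 2) * N = (q + 1) * (2 * N) by ring, hN2]
          ring
  have hNr : (0 : ℝ) < N := by exact_mod_cast hNpos
  set ρ : ℝ := P / N with hρdef
  have hPρ : (P : ℝ) = ρ * N := by rw [hρdef]; field_simp
  have hlow' : (2 * q : ℝ) ≤ ρ := by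
    rw [hρdef, le_div_iff₀ hNr]
    exact_mod_cast hlow
  have hupp' : ρ ≤ 2 * q + 2 := by
    rw [hρdef, div_le_iff₀ hNr]
    exact_mod_cast hupp
  obtain ⟨s, hs⟩ : ∃ s : ℝ, s = #S := ⟨_, rfl⟩
  rw [← hs] at hi hsmall
  have hs0 : 0 ≤ s := by rw [hs]; exact Nat.cast_nonneg _
  have hsN : s ≤ N := by rw [hs]; exact Nat.cast_le.2 hScard
  have hi' : (#(independentSets S k) : ℝ) ≤
      P - ρ * s - ρ * s * (1 - s / N) / 2 := by
    refine hi.trans (le_of_eq ?_)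
    rw [hPρ]
    field_simp
  have htouch' : (#{T ∈ powersetCard k univ \ M | ∃ e ∈ S, e ⊆ T} : ℝ) +
      #{T ∈ M | ∃ e ∈ S, e ⊆ T} + #(independentSets S k) = P := by exact_mod_cast htouch
  by_cases hhalf : 2 * #S ≤ N
  · have h := hsmall hhalf
    have hslots : #{p | slotPair τ p ∈ S} ≤ (2 * q + 2) * #S := by
      rw [card_slots_eq_sum, mul_comm, ← smul_eq_mul, ← sum_const]
      exact sum_le_sum fun e he => (hbal e (hS e he)).2
    have hslots' : (#{p | slotPair τ p ∈ S} : ℝ) ≤ (2 * q + 2) * s := by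
      rw [hs]
      exact_mod_cast hslots
    have h1 : (2 * q + 2) * s ≤ (ρ + 2) * s := by gcongr
    have : (#{p | slotPair τ p ∈ S} : ℝ) ≤
        #{T ∈ powersetCard k univ \ M | ∃ e ∈ S, e ⊆ T} := by linarith
    exact_mod_cast this
  · have hslots : 2 * q * (N - #S) ≤ #{p | slotPair τ p ∈ powersetCard 2 univ \ S} := by
      rw [card_slots_eq_sum, ← hcompl, mul_comm, ← smul_eq_mul, ← sum_const]
      refine sum_le_sum fun e he => (hbal e ?_).1
      exact mem_powersetCard_univ.1 (mem_sdiff.1 he).1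
    have htot := card_slots_add_card_slots_compl (S := S) (by omega) hτ
    have hind : #(independentSets S k) ≤ 2 * q * (N - #S) := by
      have hhalf' : (N : ℝ) ≤ 2 * s := by
        rw [hs]
        exact_mod_cast (by omega : N ≤ 2 * #S)
      have h1 : ρ * s * (1 - s / N) = ρ * (N - s) * (s / N) := by
        field_simp
      have h2 : (1 : ℝ) / 2 ≤ s / N := by
        rw [le_div_iff₀ hNr]
        linarith
      have h3 : ρ * (N - s) * (1 / 2) ≤ ρ * (N - s) * (s / N) :=
        mul_le_mul_of_nonneg_left h2 (mul_nonneg (by linarith) (by linarith))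
      have h4 : ρ * 3 / 4 * (N - s) ≤ 2 * q * (N - s) :=
        mul_le_mul_of_nonneg_right (by linarith) (by linarith)
      have h5 : (#(independentSets S k) : ℝ) ≤ 2 * q * (N - s) := by
        rw [h1] at hi'
        linarith
      rw [hs, ← Nat.cast_sub hScard] at h5
      exact_mod_cast h5
    omega

/-- Hall's condition when `k` is close to `n`: if some `k`-set is independent, then its small
complement is a vertex cover of `S`, which bounds the number of slots. -/
theorem hall_of_cover (hm : 1 ≤ m) (hτ : ∀ c, Function.Injective (τ c))
    (hM : M ⊆ powersetCard k univ) (ht : t * (m + 1) + #M = (m + 1).choose k)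
    (hk : 2 ≤ k) (hcov : 2 * t * (m + 1 - k) + #M ≤ (m - 1).choose (k - 2))
    (hS : ∀ e ∈ S, #e = 2) (hne : S.Nonempty) :
    #{p | slotPair τ p ∈ S} ≤ #{T ∈ powersetCard k univ \ M | ∃ e ∈ S, e ⊆ T} := by
  have htouch := card_touching_add (S := S) hM
  have hMS : #{T ∈ M | ∃ e ∈ S, e ⊆ T} ≤ #M := card_filter_le _ _
  have htot := card_slots_add_card_slots_compl (S := S) hm hτ
  rcases (independentSets S k).eq_empty_or_nonempty with h0 | ⟨Z, hZ⟩
  · rw [h0, card_empty] at htouch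
    omega
  simp only [independentSets, mem_filter, mem_powersetCard_univ] at hZ
  have hslots : #{p | slotPair τ p ∈ S} ≤ 2 * t * (m + 1 - k) := by
    calc #{p | slotPair τ p ∈ S} ≤ #(Zᶜ.biUnion fun v => {p | v ∈ slotPair τ p}) := by
          refine card_le_card fun p hp => ?_
          obtain ⟨v, hv, hvZ⟩ := not_subset.1 (hZ.2 _ (mem_filter.1 hp).2)
          exact mem_biUnion.2 ⟨v, mem_compl.2 hvZ, mem_filter.2 ⟨mem_univ _, hv⟩⟩
      _ ≤ ∑ v ∈ Zᶜ, #{p | v ∈ slotPair τ p} := card_biUnion_le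
      _ ≤ ∑ v ∈ Zᶜ, 2 * t := sum_le_sum fun v _ => card_slotPair_mem_le hτ v
      _ = 2 * t * (m + 1 - k) := by
          rw [sum_const, card_compl, hZ.1, Fintype.card_fin, smul_eq_mul, mul_comm]
  obtain ⟨e, he⟩ := hne
  have hsup : (m - 1).choose (k - 2) ≤ #{T ∈ powersetCard k univ | ∃ e ∈ S, e ⊆ T} := by
    have hc : #eᶜ = m - 1 := by rw [card_compl, hS e he, Fintype.card_fin]; omega
    rw [← hc, ← card_powersetCard]
    refine card_le_card_of_injOn (fun A => A ∪ e) ?_ ?_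
    · intro A hA
      rw [mem_coe, mem_powersetCard] at hA
      rw [mem_coe, mem_filter, mem_powersetCard_univ]
      refine ⟨?_, e, he, subset_union_right⟩
      rw [card_union_of_disjoint (disjoint_left.2 fun a ha => mem_compl.1 (hA.1 ha)), hA.2, hS e he]
      omega
    · intro A hA B hB h
      rw [mem_coe, mem_powersetCard] at hA hB
      have hd : ∀ C, C ⊆ eᶜ → (C ∪ e) \ e = C := fun C hC => by
        rw [union_sdiff_right, sdiff_eq_self_of_disjoint]
        exact disjoint_left.2 fun a ha => mem_compl.1 (hC ha)
      simp only at h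
      rw [← hd A hA.1, ← hd B hB.1, h]
  have hsplit : #{T ∈ powersetCard k univ | ∃ e ∈ S, e ⊆ T} =
      #{T ∈ powersetCard k univ \ M | ∃ e ∈ S, e ⊆ T} + #{T ∈ M | ∃ e ∈ S, e ⊆ T} := by
    rw [← card_union_of_disjoint (disjoint_filter_filter sdiff_disjoint), ← filter_union,
      sdiff_union_of_subset hM]
  omega

end Hall

/-! ### Numerical estimates -/

section Main

open Finset

/-- A bound on the density that makes Hall's condition hold for all sets of at most half the
pairs, when up to `m` sets are deleted. The right-hand side is concave in `s`, and the case
`s = 1` is the critical one. -/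
theorem add_le_of_density {ρ N s m : ℝ} (hN : 100 ≤ N) (hm : 19 ≤ m) (hs : 1 ≤ s)
    (hsN : 2 * s ≤ N) (hρ : 2 * (m + 2) ≤ ρ * (1 - 1 / N)) :
    2 * s + m ≤ ρ * s * (1 - s / N) / 2 := by
  have hN0 : 0 < N := by linarith
  have hu0 : 0 < 1 / N := by positivity
  have hu1 : 1 / N ≤ 1 / 100 := one_div_le_one_div_of_le (by norm_num) hN
  have hρ1 : 42 ≤ ρ := by
    by_contra! h
    nlinarith
  have h1 : s * (1 / 2 - 1 / N) + 1 / 2 ≤ s * (1 - s / N) := by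
    have : 0 ≤ (s - 1) * (N / 2 - s) * (1 / N) :=
      mul_nonneg (mul_nonneg (by linarith) (by linarith)) hu0.le
    have e : (s - 1) * (N / 2 - s) * (1 / N) =
        s * (1 - s / N) - (s * (1 / 2 - 1 / N) + 1 / 2) := by
      field_simp
      ring
    linarith
  have h2 : ρ * (s * (1 / 2 - 1 / N) + 1 / 2) ≤ ρ * (s * (1 - s / N)) :=
    mul_le_mul_of_nonneg_left h1 (by linarith)
  have h3 : 0 ≤ (s - 1) * (ρ * (1 / 2 - 1 / N) - 4) :=
    mul_nonneg (by linarith) (by nlinarith)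
  nlinarith

theorem cast_choose_succ_eq_mul_div (n k : ℕ) (hk : k ≤ n) :
    (n.choose (k + 1) : ℝ) = n.choose k * (n - k) / (k + 1) := by
  have h : ((n.choose (k + 1) * (k + 1) : ℕ) : ℝ) = ((n.choose k * (n - k) : ℕ) : ℝ) := by
    exact_mod_cast Nat.choose_succ_right_eq n k
  rw [Nat.cast_mul, Nat.cast_mul, Nat.cast_sub hk] at h
  push_cast at h
  field_simp
  linarith

theorem choose_le_choose_of_le_half {n j k : ℕ} (hjk : j ≤ k) (hk : k ≤ n / 2) :
    n.choose j ≤ n.choose k := by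
  induction k, hjk using Nat.le_induction with
  | base => exact le_rfl
  | succ k hjk ih => exact (ih (by omega)).trans (Nat.choose_le_succ_of_lt_half_left (by omega))

theorem choose_le_choose_of_le_of_le_sub {n j k : ℕ} (hjk : j ≤ k) (hk : k ≤ n - j) (hjn : j ≤ n) :
    n.choose j ≤ n.choose k := by
  rcases le_or_gt k (n / 2) with h | h
  · exact choose_le_choose_of_le_half hjk h
  · rw [← Nat.choose_symm (show k ≤ n by omega)]
    exact choose_le_choose_of_le_half (by omega) (by omega)

theorem density_bound {m k : ℕ} (h : 4 ≤ k ∧ k ≤ m - 3 ∧ 29 ≤ m ∨ 5 ≤ k ∧ k ≤ m - 4 ∧ 19 ≤ m) :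
    (2 * (m + 2) : ℝ) ≤
      (m + 1).choose k / (m + 1).choose 2 * (1 - 1 / (m + 1).choose 2) := by
  have c2 : ((m + 1).choose 2 : ℝ) = (m + 1) * m / 2 := by
    rw [Nat.cast_choose_two]
    push_cast
    ring
  have hm : 19 ≤ m := by omega
  have hmr : (19 : ℝ) ≤ m := by exact_mod_cast hm
  have c3 := cast_choose_succ_eq_mul_div (m + 1) 2 (by omega)
  have c4 := cast_choose_succ_eq_mul_div (m + 1) 3 (by omega)
  have c5 := cast_choose_succ_eq_mul_div (m + 1) 4 (by omega)
  push_cast at c3 c4 c5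
  set N : ℝ := ((m + 1).choose 2 : ℝ) with hN
  have hNpos : 0 < N := by rw [c2]; positivity
  have hfac : (1 : ℝ) - 1 / N = (m - 1) * (m + 2) / ((m + 1) * m) := by
    rw [c2]
    field_simp
    ring
  have hfac0 : 0 ≤ (1 : ℝ) - 1 / N := by
    rw [hfac]
    exact div_nonneg (mul_nonneg (by linarith) (by linarith)) (by positivity)
  rcases h with ⟨h1, h2, h3⟩ | ⟨h1, h2, h3⟩
  · have hmr : (29 : ℝ) ≤ m := by exact_mod_cast h3
    have hP : ((m + 1).choose 4 : ℝ) ≤ (m + 1).choose k := by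
      exact_mod_cast choose_le_choose_of_le_of_le_sub h1 (by omega) (by omega)
    have hq : ((m + 1).choose 4 : ℝ) / N = (m - 1) * (m - 2) / 12 := by
      rw [div_eq_iff hNpos.ne', c4, c3]
      ring
    calc (2 * (m + 2) : ℝ) ≤ (m - 1) * (m - 2) / 12 * (1 - 1 / N) := by
          rw [hfac, div_mul_div_comm, le_div_iff₀ (by positivity)]
          have h : (24 * ((m + 1) * m) : ℝ) ≤ (m - 1) * (m - 1) * (m - 2) := by
            obtain ⟨x, hx⟩ : ∃ x : ℝ, x = m - 29 := ⟨_, rfl⟩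
            have hx0 : 0 ≤ x := by linarith
            rw [show (m : ℝ) = x + 29 by linarith]
            have : 0 ≤ x ^ 3 := by positivity
            nlinarith
          nlinarith
      _ = ((m + 1).choose 4 : ℝ) / N * (1 - 1 / N) := by rw [hq]
      _ ≤ _ := by gcongr
  · have hP : ((m + 1).choose 5 : ℝ) ≤ (m + 1).choose k := by
      exact_mod_cast choose_le_choose_of_le_of_le_sub h1 (by omega) (by omega)
    have hq : ((m + 1).choose 5 : ℝ) / N = (m - 1) * (m - 2) * (m - 3) / 60 := by
      rw [div_eq_iff hNpos.ne', c5, c4, c3]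
      ring
    calc (2 * (m + 2) : ℝ) ≤ (m - 1) * (m - 2) * (m - 3) / 60 * (1 - 1 / N) := by
          rw [hfac, div_mul_div_comm, le_div_iff₀ (by positivity)]
          have h : (120 * ((m + 1) * m) : ℝ) ≤ (m - 1) * (m - 1) * ((m - 2) * (m - 3)) := by
            obtain ⟨x, hx⟩ : ∃ x : ℝ, x = m - 19 := ⟨_, rfl⟩
            have hx0 : 0 ≤ x := by linarith
            rw [show (m : ℝ) = x + 19 by linarith]
            have : 0 ≤ x ^ 3 := by positivity
            have : 0 ≤ x ^ 4 := by positivity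
            nlinarith
          nlinarith
      _ = ((m + 1).choose 5 : ℝ) / N * (1 - 1 / N) := by rw [hq]
      _ ≤ _ := by gcongr

/-- The counting condition of `hall_of_cover` for `k = n - j` with `1 ≤ j ≤ 4`. -/
theorem cover_bound {m t k μ : ℕ} (hm : 19 ≤ m) (hk : k ≤ m) (hk' : m - 3 ≤ k) (hμ : μ ≤ m)
    (ht : t * (m + 1) + μ = (m + 1).choose k) :
    2 * t * (m + 1 - k) + μ ≤ (m - 1).choose (k - 2) := by
  obtain ⟨j, hj⟩ : ∃ j, j = m + 1 - k := ⟨_, rfl⟩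
  have hj1 : 1 ≤ j := by omega
  have hj4 : j ≤ 4 := by omega
  have e1 : (m + 1).choose k = (m + 1).choose j := by
    rw [hj, Nat.choose_symm (by omega)]
  have e2 : (m - 1).choose (k - 2) = (m - 1).choose j := by
    rw [← Nat.choose_symm (show j ≤ m - 1 by omega)]
    congr 1
    omega
  rw [e2, ← hj]
  rw [e1] at ht
  have hμr : (μ : ℝ) ≤ m := by exact_mod_cast hμ
  have hmr : (19 : ℝ) ≤ m := by exact_mod_cast hm
  have hcast : ((m - 1 : ℕ) : ℝ) = m - 1 := by
    rw [Nat.cast_sub (by omega)]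
    norm_num
  have htr : (t * (m + 1) + μ : ℝ) = (m + 1).choose j := by exact_mod_cast ht
  have c2 : ((m + 1).choose 2 : ℝ) = (m + 1) * m / 2 := by
    rw [Nat.cast_choose_two]
    push_cast
    ring
  have c3 := cast_choose_succ_eq_mul_div (m + 1) 2 (by omega)
  have c4 := cast_choose_succ_eq_mul_div (m + 1) 3 (by omega)
  have d2 : ((m - 1).choose 2 : ℝ) = (m - 1) * (m - 2) / 2 := by
    rw [Nat.cast_choose_two, hcast]
    ring
  have d3 := cast_choose_succ_eq_mul_div (m - 1) 2 (by omega)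
  have d4 := cast_choose_succ_eq_mul_div (m - 1) 3 (by omega)
  push_cast at c3 c4
  rw [hcast] at d3 d4
  norm_num at d3 d4
  have hμ0 : (0 : ℝ) ≤ μ := by positivity
  suffices h : ((2 * t * j + μ : ℕ) : ℝ) ≤ ((m - 1).choose j : ℕ) by exact_mod_cast h
  have htle : (t * (m + 1) : ℝ) ≤ (m + 1).choose j := by linarith
  push_cast
  have hm1 : (0 : ℝ) < m + 1 := by linarith
  have : j = 1 ∨ j = 2 ∨ j = 3 ∨ j = 4 := by omega
  rcases this with h | h | h | h <;> rw [h] at htle ht ⊢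
  · rw [Nat.choose_one_right] at ht
    have ht1 : t = 1 := by
      rcases Nat.lt_or_ge t 1 with h0 | h0
      · have : t = 0 := by omega
        subst this
        omega
      · rcases Nat.lt_or_ge 1 t with h2 | h2
        · nlinarith
        · omega
    subst ht1
    have : μ = 0 := by omega
    subst this
    rw [Nat.choose_one_right, hcast]
    push_cast
    linarith
  · have : (t : ℝ) ≤ m / 2 := by
      refine le_of_mul_le_mul_right (htle.trans (le_of_eq ?_)) hm1
      rw [c2]
      ring
    rw [d2]
    push_cast
    nlinarith
  · have : (t : ℝ) ≤ m * (m - 1) / 6 := by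
      refine le_of_mul_le_mul_right (htle.trans (le_of_eq ?_)) hm1
      rw [c3, c2]
      ring
    rw [d3, d2]
    push_cast
    nlinarith [mul_nonneg (sub_nonneg.2 hmr) (sub_nonneg.2 hmr)]
  · have : (t : ℝ) ≤ m * (m - 1) * (m - 2) / 24 := by
      refine le_of_mul_le_mul_right (htle.trans (le_of_eq ?_)) hm1
      rw [c4, c3, c2]
      ring
    rw [d4, d3, d2]
    push_cast
    have h1 : (88 : ℝ) ≤ (m - 3) * (m - 4) - 8 * m := by nlinarith
    have h2 : (m : ℝ) ≤ (m - 1) * (m - 2) := by nlinarith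
    have h3 : ((m : ℝ) - 1) * (m - 2) * 88 ≤ (m - 1) * (m - 2) * ((m - 3) * (m - 4) - 8 * m) :=
      mul_le_mul_of_nonneg_left h1 (by linarith)
    linarith

/-! ### Deleting a set of edges -/

open Classical in
/-- The deleted edges as finite sets of size `k`. -/
noncomputable def deletedFinsets (n k : ℕ) (M : Set (Set (Fin n))) : Finset (Finset (Fin n)) :=
  {T ∈ powersetCard k univ | (T : Set (Fin n)) ∈ M}

theorem deletedFinsets_subset (n k : ℕ) (M : Set (Set (Fin n))) :
    deletedFinsets n k M ⊆ powersetCard k univ := by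
  classical exact filter_subset _ _

theorem mem_deletedFinsets {n k : ℕ} {M : Set (Set (Fin n))} {T : Finset (Fin n)} :
    T ∈ deletedFinsets n k M ↔ #T = k ∧ (T : Set (Fin n)) ∈ M := by
  simp [deletedFinsets]

theorem mem_deleteEdges_iff {n k : ℕ} (M : Set (Set (Fin n))) (e : Set (Fin n)) :
    e ∈ ((Hypergraph.completeUniform n k).deleteEdges M).edgeSet ↔
      ∃ T ∈ powersetCard k univ \ deletedFinsets n k M, (T : Set (Fin n)) = e := by
  classical
  simp only [mem_sdiff, mem_powersetCard_univ, mem_deletedFinsets]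
  constructor
  · rintro ⟨h1, h2⟩
    refine ⟨e.toFinset, ⟨?_, fun h => h2 ?_⟩, Set.coe_toFinset e⟩
    · rw [← Set.ncard_eq_toFinset_card']
      exact h1
    · simpa using h.2
  · rintro ⟨T, ⟨h1, h2⟩, rfl⟩
    refine ⟨?_, fun h => h2 ⟨h1, h⟩⟩
    change (T : Set (Fin n)).ncard = k
    rwa [Set.ncard_coe_finset]

theorem card_deletedFinsets {n k : ℕ} {M : Set (Set (Fin n))}
    (hM : M ⊆ (Hypergraph.completeUniform n k).edgeSet) : #(deletedFinsets n k M) = M.ncard := by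
  classical
  have h : (((deletedFinsets n k M).image SetLike.coe : Finset (Set (Fin n))) :
      Set (Set (Fin n))) = M := by
    ext e
    simp only [coe_image, Set.mem_image, mem_coe, mem_deletedFinsets]
    constructor
    · rintro ⟨T, ⟨-, h⟩, rfl⟩
      exact h
    · intro h
      refine ⟨e.toFinset, ⟨?_, by simpa using h⟩, Set.coe_toFinset e⟩
      rw [← Set.ncard_eq_toFinset_card']
      exact hM h
  rw [← card_image_of_injective _ Finset.coe_injective, ← Set.ncard_coe_finset, h]

theorem ncard_deleteEdges_add {n : ℕ} (k : ℕ) (M : Set (Set (Fin n))) :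
    ((Hypergraph.completeUniform n k).edgeSet \ M).ncard + #(deletedFinsets n k M) =
      n.choose k := by
  classical
  have h : ((Hypergraph.completeUniform n k).edgeSet \ M) =
      (((powersetCard k univ \ deletedFinsets n k M).image SetLike.coe : Finset (Set (Fin n))) :
        Set (Set (Fin n))) := by
    ext e
    rw [coe_image]
    exact mem_deleteEdges_iff M e
  rw [h, Set.ncard_coe_finset, card_image_of_injective _ Finset.coe_injective,
    card_sdiff_add_card_eq_card (deletedFinsets_subset n k M), card_powersetCard, card_univ,
    Fintype.card_fin]

theorem hasDecomposition_deleteEdges_of_hall {m t k : ℕ} {M : Set (Set (Fin (m + 1)))} (hm : 2 ≤ m)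
    (ht : t * (m + 1) + #(deletedFinsets (m + 1) k M) = (m + 1).choose k)
    (hall : ∀ τ : Fin t → Fin (m + 1) → Fin (m + 1), (∀ c, Function.Injective (τ c)) →
      (∀ e : Finset (Fin (m + 1)), #e = 2 →
        2 * (t / m) ≤ #{p | slotPair τ p = e} ∧ #{p | slotPair τ p = e} ≤ 2 * (t / m) + 2) →
      ∀ S : Finset (Finset (Fin (m + 1))), (∀ e ∈ S, #e = 2) → S.Nonempty →
      #{p | slotPair τ p ∈ S} ≤
        #{T ∈ powersetCard k univ \ deletedFinsets (m + 1) k M | ∃ e ∈ S, e ⊆ T}) :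
    ((Hypergraph.completeUniform (m + 1) k).deleteEdges M).HasHamiltonBergeDecomposition := by
  obtain ⟨τ, hτ, hbal⟩ := exists_balanced_cycles hm t
  refine hasHamiltonBergeDecomposition_of_hall (by omega) hτ ?_ (hall τ hτ hbal) rfl
    (mem_deleteEdges_iff M)
  have := card_sdiff_add_card_eq_card (deletedFinsets_subset (m + 1) k M)
  rw [card_powersetCard, card_univ, Fintype.card_fin] at this
  omega

theorem hasDecomposition_of_four_le {m k : ℕ} (hkm : k ≤ m)
    (h : 5 ≤ k ∧ 19 ≤ m ∨ k = 4 ∧ 29 ≤ m) {M : Set (Set (Fin (m + 1)))}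
    (hM : M ⊆ (Hypergraph.completeUniform (m + 1) k).edgeSet) (hcard : M.ncard ≤ m)
    (hdvd : m + 1 ∣ ((Hypergraph.completeUniform (m + 1) k).edgeSet \ M).ncard) :
    ((Hypergraph.completeUniform (m + 1) k).deleteEdges M).HasHamiltonBergeDecomposition := by
  obtain ⟨t, ht⟩ := hdvd
  have ht' := ncard_deleteEdges_add k M
  rw [ht, mul_comm] at ht'
  rw [← card_deletedFinsets hM] at hcard
  refine hasDecomposition_deleteEdges_of_hall (t := t) (by omega) ht' ?_
  intro τ hτ hbal S hS hne
  by_cases hk : k ≤ m - 4 ∨ k = 4 ∧ 29 ≤ m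
  · have hd := density_bound (m := m) (k := k) (by omega)
    have hmr : (19 : ℝ) ≤ m := by exact_mod_cast (by omega : 19 ≤ m)
    have hN : (100 : ℝ) ≤ (m + 1).choose 2 := by
      rw [Nat.cast_choose_two]
      push_cast
      nlinarith
    have hs : (1 : ℝ) ≤ #S := by exact_mod_cast hne.card_pos
    refine hall_of_density (by omega) hτ hbal (deletedFinsets_subset _ _ _) hcard ht' (by omega)
      (by omega) ?_ hS ?_
    · have h0 : (0 : ℝ) ≤ (m + 1).choose k / (m + 1).choose 2 := by positivity
      have h1 : (0 : ℝ) ≤ 1 / (m + 1).choose 2 := by positivity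
      nlinarith
    · intro hhalf
      have hμ : (#{T ∈ deletedFinsets (m + 1) k M | ∃ e ∈ S, e ⊆ T} : ℝ) ≤ m := by
        exact_mod_cast (card_filter_le _ _).trans hcard
      have := add_le_of_density hN hmr hs (by exact_mod_cast hhalf) hd
      linarith
  · exact hall_of_cover (by omega) hτ (deletedFinsets_subset _ _ _) ht' (by omega)
      (cover_bound (by omega) hkm (by omega) hcard ht') hS hne

/-- For triples the deleted set is a matching or empty, and so each pair lies in at most one deleted
triple. -/
theorem hasDecomposition_three {m : ℕ} (hm : 99 ≤ m) {M : Set (Set (Fin (m + 1)))}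
    (hM : M ⊆ (Hypergraph.completeUniform (m + 1) 3).edgeSet) (hcard : M.ncard ≤ m)
    (hdisj : M.PairwiseDisjoint id)
    (hdvd : m + 1 ∣ ((Hypergraph.completeUniform (m + 1) 3).edgeSet \ M).ncard) :
    ((Hypergraph.completeUniform (m + 1) 3).deleteEdges M).HasHamiltonBergeDecomposition := by
  obtain ⟨t, ht⟩ := hdvd
  have ht' := ncard_deleteEdges_add 3 M
  rw [ht, mul_comm] at ht'
  rw [← card_deletedFinsets hM] at hcard
  refine hasDecomposition_deleteEdges_of_hall (t := t) (by omega) ht' ?_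
  intro τ hτ hbal S hS hne
  have hmr : (99 : ℝ) ≤ m := by exact_mod_cast hm
  have hN : (0 : ℝ) < (m + 1).choose 2 := by exact_mod_cast Nat.choose_pos (by omega)
  have c3 := cast_choose_succ_eq_mul_div (m + 1) 2 (by omega)
  have hρ : ((m + 1).choose 3 : ℝ) / (m + 1).choose 2 = (m - 1) / 3 := by
    rw [div_eq_iff hN.ne', c3]
    push_cast
    ring
  refine hall_of_density (by omega) hτ hbal (deletedFinsets_subset _ _ _) hcard ht' le_rfl
    (by omega) (by rw [hρ]; linarith) hS ?_
  intro hhalf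
  rw [hρ]
  have hμ : #{T ∈ deletedFinsets (m + 1) 3 M | ∃ e ∈ S, e ⊆ T} ≤ #S := by
    refine card_le_card_of_forall_subsingleton (fun T e => e ⊆ T) (fun T hT => ?_) ?_
    · obtain ⟨-, e, he, heT⟩ := mem_filter.1 hT
      exact ⟨e, he, heT⟩
    · rintro e he T ⟨hT, heT⟩ T' ⟨hT', heT'⟩
      rw [mem_filter, mem_deletedFinsets] at hT hT'
      obtain ⟨a, ha⟩ : e.Nonempty := card_pos.1 (by rw [hS e he]; norm_num)
      refine Finset.coe_injective (hdisj.elim hT.1.2 hT'.1.2 fun hd => ?_)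
      exact Set.disjoint_left.1 hd (heT ha) (heT' ha)
  have hμ' : (#{T ∈ deletedFinsets (m + 1) 3 M | ∃ e ∈ S, e ⊆ T} : ℝ) ≤ #S := by exact_mod_cast hμ
  have hx : (#S : ℝ) / (m + 1).choose 2 ≤ 1 / 2 := by
    rw [div_le_iff₀ hN]
    have : (2 * #S : ℝ) ≤ (m + 1).choose 2 := by exact_mod_cast hhalf
    linarith
  have hs0 : (0 : ℝ) ≤ #S := by positivity
  have : (m - 1) / 3 * #S * (1 / 2) ≤
      ((m : ℝ) - 1) / 3 * #S * (1 - #S / (m + 1).choose 2) :=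
    mul_le_mul_of_nonneg_left (by linarith) (mul_nonneg (by linarith) hs0)
  nlinarith

/-! ### Perfect matchings of the complete `3`-uniform hypergraph -/

theorem dvd_choose_three_iff {n : ℕ} (hn : 3 ≤ n) : n ∣ n.choose 3 ↔ ¬ 3 ∣ n := by
  obtain ⟨m, rfl⟩ : ∃ m, n = m + 1 := ⟨n - 1, by omega⟩
  have h : (m + 1) * m.choose 2 = (m + 1).choose 3 * 3 := Nat.add_one_mul_choose_eq m 2
  constructor
  · rintro ⟨c, hc⟩ ⟨d, hd⟩
    rw [hc] at h
    have h1 : m.choose 2 = c * 3 := by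
      apply Nat.eq_of_mul_eq_mul_left (show 0 < m + 1 by omega)
      rw [h]; ring
    have h2 : m.choose 2 * 2 = m * (m - 1) := by
      rw [Nat.choose_two_right]
      exact Nat.div_mul_cancel (Nat.even_mul_pred_self m).two_dvd
    obtain ⟨d, rfl⟩ : ∃ d', d = d' + 1 := ⟨d - 1, by omega⟩
    have hm : m = 3 * d + 2 := by omega
    rw [h1, hm] at h2
    have h3 : c * 3 * 2 = 3 * (3 * d * d + 3 * d) + 2 := by
      rw [h2, show 3 * d + 2 - 1 = 3 * d + 1 by omega]
      ring
    omega
  · intro h3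
    have hc : Nat.Coprime (m + 1) 3 := ((Nat.prime_three.coprime_iff_not_dvd).2 h3).symm
    exact hc.dvd_of_dvd_mul_right ⟨_, h.symm⟩

theorem ncard_perfectMatching {n : ℕ} {M : Set (Set (Fin n))}
    (hM : (Hypergraph.completeUniform n 3).IsPerfectMatching M) : 3 * M.ncard = n := by
  classical
  have h1 : #((deletedFinsets n 3 M).biUnion id) = ∑ T ∈ deletedFinsets n 3 M, #T := by
    refine card_biUnion fun T hT T' hT' hne => ?_
    rw [mem_coe, mem_deletedFinsets] at hT hT'
    have := hM.pairwiseDisjoint hT.2 hT'.2 (fun h => hne (Finset.coe_injective h))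
    exact Finset.disjoint_coe.1 this
  have h2 : (deletedFinsets n 3 M).biUnion id = univ := by
    rw [eq_univ_iff_forall]
    intro v
    have hv : v ∈ ⋃₀ M := by rw [hM.sUnion_eq]; exact Set.mem_univ v
    obtain ⟨e, he, hve⟩ := hv
    refine mem_biUnion.2 ⟨e.toFinset, mem_deletedFinsets.2 ⟨?_, by simpa using he⟩, by simpa⟩
    rw [← Set.ncard_eq_toFinset_card']
    exact hM.subset_edgeSet he
  rw [h2, sum_const_nat (m := 3) (fun T hT => (mem_deletedFinsets.1 hT).1), card_univ,
    Fintype.card_fin, card_deletedFinsets hM.subset_edgeSet] at h1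
  omega

/-- Consecutive blocks of three vertices form a perfect matching. -/
theorem exists_perfectMatching {n : ℕ} (hn : 3 ∣ n) :
    ∃ M, (Hypergraph.completeUniform n 3).IsPerfectMatching M := by
  obtain ⟨d, rfl⟩ := hn
  refine ⟨Set.range fun i : Fin d => {v : Fin (3 * d) | v.val / 3 = i.val}, ?_, ?_, ?_⟩
  · rintro _ ⟨i, rfl⟩
    have hi := i.2
    change Set.ncard _ = 3
    rw [Set.ncard_eq_three]
    refine ⟨⟨3 * i, by omega⟩, ⟨3 * i + 1, by omega⟩, ⟨3 * i + 2, by omega⟩, ?_, ?_, ?_, ?_⟩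
    · simp
    · simp
    · simp
    · ext v
      simp only [Set.mem_ofPred_eq, Set.mem_insert_iff, Set.mem_singleton_iff, Fin.ext_iff]
      omega
  · rintro _ ⟨i, rfl⟩ _ ⟨j, rfl⟩ hne
    refine Set.disjoint_left.2 fun v hv hv' => hne ?_
    simp only [id, Set.mem_ofPred_eq] at hv hv'
    simp only [← hv, ← hv']
  · refine Set.eq_univ_of_forall fun v => ?_
    exact ⟨_, ⟨⟨v / 3, by omega⟩, rfl⟩, rfl⟩

end Main

theorem theorem2 (k n : ℕ) (hk : 3 ≤ k) (hkn : k < n) :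
    ((5 ≤ k ∧ 20 ≤ n ∨ k = 4 ∧ 30 ≤ n) →
      ∀ M : Set (Set (Fin n)), M ⊆ (Hypergraph.completeUniform n k).edgeSet →
        M.ncard < n →
        n ∣ ((Hypergraph.completeUniform n k).edgeSet \ M).ncard →
        ((Hypergraph.completeUniform n k).deleteEdges M).HasHamiltonBergeDecomposition) ∧
    (k = 3 ∧ 100 ≤ n →
      (¬ n ∣ n.choose 3 →
        (∃ M, (Hypergraph.completeUniform n 3).IsPerfectMatching M) ∧
        ∀ M, (Hypergraph.completeUniform n 3).IsPerfectMatching M →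
          ((Hypergraph.completeUniform n 3).deleteEdges M).HasHamiltonBergeDecomposition) ∧
      (n ∣ n.choose 3 →
        ((Hypergraph.completeUniform n 3).deleteEdges ∅).HasHamiltonBergeDecomposition)) := by
  obtain ⟨m, rfl⟩ : ∃ m, n = m + 1 := ⟨n - 1, by omega⟩
  refine ⟨fun h M hM hcard hdvd => hasDecomposition_of_four_le (by omega) (by omega) hM (by omega)
    hdvd, fun ⟨_, hn⟩ => ⟨fun hnd => ?_, fun hd => ?_⟩⟩
  · rw [dvd_choose_three_iff (by omega), not_not] at hnd
    refine ⟨exists_perfectMatching hnd, fun M hM => ?_⟩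
    have h3 := ncard_perfectMatching hM
    refine hasDecomposition_three (by omega) hM.subset_edgeSet (by omega) hM.pairwiseDisjoint ?_
    have h := ncard_deleteEdges_add 3 M
    rw [card_deletedFinsets hM.subset_edgeSet] at h
    -- with `m + 1 = 3 * (d + 1)` the number of remaining triples is
    -- `(m + 1) * (3 * (d * (d + 1) / 2))`
    obtain ⟨d, hd⟩ : ∃ d, m = 3 * d + 2 := ⟨m / 3, by omega⟩
    obtain ⟨r, hr⟩ := (Nat.even_mul_succ_self d).two_dvd
    refine ⟨3 * r, ?_⟩
    have h1 : (m + 1) * m.choose 2 = (m + 1).choose 3 * 3 := Nat.add_one_mul_choose_eq m 2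
    have h2 : m.choose 2 * 2 = m * (m - 1) := by
      rw [Nat.choose_two_right]
      exact Nat.div_mul_cancel (Nat.even_mul_pred_self m).two_dvd
    have h4 : m.choose 2 = 9 * r + 1 := by
      have : m * (m - 1) = 9 * (d * (d + 1)) + 2 := by
        rw [hd, show 3 * d + 2 - 1 = 3 * d + 1 by omega]
        ring
      rw [hr] at this
      omega
    rw [h4] at h1
    have h5 : (m + 1) * (9 * r + 1) = 3 * ((m + 1) * (3 * r)) + (m + 1) := by ring
    omega
  · have h := ncard_deleteEdges_add (n := m + 1) 3 ∅
    rw [card_deletedFinsets (Set.empty_subset _), Set.ncard_empty, add_zero] at h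
    refine hasDecomposition_three (by omega) (Set.empty_subset _) (by simp)
      Set.pairwiseDisjoint_empty ?_
    rwa [h]
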